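/- Let $d\ge 3$ and let $\theta\in\mathbb{Z}^d$ with $\theta_i\ge 1$ for all $i$. For $x,y\in\mathbb{Z}^d$ write $x\le_{\mathrm{lex}}y$ if $x=y$ or there is an index $i$ with $x_i<y_i$ and $x_k=y_k$ for all $k>i$, and write $x\preceq_{\mathrm{grlex}}y$ if $\sum_i x_i<\sum_i y_i$, or $\sum_i x_i=\sum_i y_i$ and $x\le_{\mathrm{lex}}y$. Let $$P=\operatorname{conv}\{x\in\mathbb{Z}^d : 0\le x\preceq_{\mathrm{grlex}}\theta\}\subset\mathbb{R}^d .$$ Call a pair of distinct vertices of a polytope antipodal if no facet of the polytope contains both of them. Then: 1. $P$ is a Dantzig figure generated by $0$ and $\theta$: it is a $d$-dimensional polytope with exactly $2d$ facets, $0$ and $\theta$ are distinct vertices of $P$, and no facet of $P$ contains both of them. Moreover, every facet of $P$ contains $0$ or $\theta$. 2. $\{0,\theta\}$ is the only antipodal pair of vertices of $P$: for vertices $u\ne v$ of $P$, the pair $(u,v)$ is antipodal if and only if $\{u,v\}=\{0,\theta\}$. -/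

import Mathlib

/-! ### Polytopes, facets, antipodal vertex pairs, Dantzig figures -/

section Polytope

variable {E : Type*} [NormedAddCommGroup E] [NormedSpace ℝ E]

/-- `X` is a `d`-polytope: the convex hull of a finite nonempty set of points, of affine
dimension `d`. -/
def IsDPolytope (d : ℕ) (X : Set E) : Prop :=
  (∃ s : Set E, s.Finite ∧ s.Nonempty ∧ X = convexHull ℝ s) ∧
    Module.finrank ℝ (vectorSpan ℝ X) = d

/-- `F` is a facet of `X`: a nonempty face of `X`, that is, the set of maximisers over `X` of some
linear functional, whose affine dimension is one less than that of `X`. -/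
def IsFacet (X F : Set E) : Prop :=
  IsExposed ℝ X F ∧ F.Nonempty ∧
    Module.finrank ℝ (vectorSpan ℝ F) + 1 = Module.finrank ℝ (vectorSpan ℝ X)

/-- A `(d,n)`-polytope is a `d`-polytope with exactly `n` facets. -/
def IsDNPolytope (d n : ℕ) (X : Set E) : Prop :=
  IsDPolytope d X ∧ {F : Set E | IsFacet X F}.encard = n

/-- `(u, v)` is an antipodal vertex pair of `X`: two distinct vertices that do not lie on a common
facet. The vertices of a polytope are its extreme points. -/
def IsAntipodalVertexPair (X : Set E) (u v : E) : Prop :=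
  u ∈ X.extremePoints ℝ ∧ v ∈ X.extremePoints ℝ ∧ u ≠ v ∧
    ∀ F : Set E, IsFacet X F → ¬ (u ∈ F ∧ v ∈ F)

/-- `X` is a (`d`-dimensional) Dantzig figure generated by `u` and `v`: a `(d,2d)`-polytope whose
distinct vertices `u` and `v` do not share a facet. -/
def IsDantzigFigure (d : ℕ) (X : Set E) (u v : E) : Prop :=
  IsDNPolytope d (2 * d) X ∧ IsAntipodalVertexPair X u v

end Polytope

/-! ### The graded lexicographic order and its polytope -/

/-- The lexicographic order on `ℤ^d`, with coordinates compared from right to left: the last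
coordinate in which `x` and `y` differ decides. -/
def LexLE {d : ℕ} (x y : Fin d → ℤ) : Prop :=
  x = y ∨ ∃ i, x i < y i ∧ ∀ k, i < k → x k = y k

/-- The graded lexicographic order on `ℤ^d`. -/
def GrlexLE {d : ℕ} (x y : Fin d → ℤ) : Prop :=
  ∑ i, x i < ∑ i, y i ∨ (∑ i, x i = ∑ i, y i ∧ LexLE x y)

/-- An integer vector as a point of `ℝ^d`. -/
def intPoint {d : ℕ} (x : Fin d → ℤ) : Fin d → ℝ := fun i => (x i : ℝ)

/-- The grlex polytope `conv {x ∈ ℤ^d : 0 ≤ x ⪯ θ}` in `ℝ^d`. -/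
def grlexPolytope {d : ℕ} (θ : Fin d → ℤ) : Set (Fin d → ℝ) :=
  convexHull ℝ (intPoint '' {x : Fin d → ℤ | (∀ i, 0 ≤ x i) ∧ GrlexLE x θ})

/-! Both `0` and `θ` are simple vertices in the sense of `IsSimpleVertex`: `d` functionals are
maximal there, and `d` points of the polytope each leave exactly one of the corresponding
hyperplanes. The differences to the vertex then form a basis that is dual, up to scaling, to the
functionals, so exactly `d` facets pass through the vertex. At `0` these are the coordinate facets.
At `θ` the normals `facetCoeff` come from a recursion; they are nonnegative and pair positively with
`θ`, so none of these facets contains `0`.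

That no facet misses both points is `pairing_eq_of_cover`, an exchange argument: if the maximisers
of a functional are not confined to one coordinate hyperplane, `θ` is among them. A facet missing
`θ` therefore lies in a coordinate facet, equals it, and contains `0`. This makes `2d` facets in
all.

For antipodal pairs, let `S` be the coordinate sum of `θ`. Exchanging units shows that a vertex of
sum below `S` is `0` or `(S - 1) e_d`, and that a vertex of sum `S` other than `θ` vanishes in one
of the first two coordinates. As `d ≥ 3`, the former vanish in both, so the coordinate facets leave
only `θ` as an antipode; and `(S - 1) e_d` shares a facet with `θ`. Two vertices of sum `S` share
the facet on which the sum is `S`. -/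

/-! ### Facets through a simple vertex. -/

section SimpleVertex

variable {E : Type*} [NormedAddCommGroup E] [NormedSpace ℝ E]

theorem vectorSpan_le_ker_of_const {F : Set E} {l : E →L[ℝ] ℝ} {c : ℝ} (h : ∀ x ∈ F, l x = c) :
    vectorSpan ℝ F ≤ LinearMap.ker (l : E →ₗ[ℝ] ℝ) := by
  rw [vectorSpan_def, Submodule.span_le]
  rintro _ ⟨x, hx, y, hy, rfl⟩
  simp [h x hx, h y hy]

/-- Equal dimensions force equal directions, so a functional exposing `F` is constant on `G` as
well, and every point of `G` is one of its maximisers. -/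
theorem IsFacet.eq_of_subset [FiniteDimensional ℝ E] {X F G : Set E} (hF : IsFacet X F)
    (hG : IsFacet X G) (h : F ⊆ G) : F = G := by
  obtain ⟨l, hl⟩ := hF.1 hF.2.1
  have hspan : vectorSpan ℝ F = vectorSpan ℝ G :=
    Submodule.eq_of_le_of_finrank_eq (vectorSpan_mono ℝ h) (by
      have h1 := hF.2.2
      have h2 := hG.2.2
      omega)
  obtain ⟨z, hz⟩ := hF.2.1
  have hz' := hz
  rw [hl] at hz'
  refine h.antisymm fun x hx => ?_
  have hker : vectorSpan ℝ F ≤ LinearMap.ker (l : E →ₗ[ℝ] ℝ) := by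
    refine vectorSpan_le_ker_of_const (c := l z) fun y hy => ?_
    rw [hl] at hy
    exact le_antisymm (hz'.2 y hy.1) (hy.2 z hz'.1)
  have hxz : x -ᵥ z ∈ vectorSpan ℝ F := hspan ▸ vsub_mem_vectorSpan ℝ hx (h hz)
  have hlx : l x = l z := by
    have := hker hxz
    simpa [sub_eq_zero] using this
  rw [hl]
  exact ⟨hG.1.subset hx, fun y hy => hlx ▸ hz'.2 y hy⟩

/-- A point `u` of `X` at which the functionals `g i` attain their maxima over `X`, together with
points `p k` of `X` at which exactly the functionals `g i` with `i ≠ k` are maximal. -/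
structure IsSimpleVertex {ι : Type*} (X : Set E) (u : E) (g : ι → E →L[ℝ] ℝ) (p : ι → E) :
    Prop where
  mem : u ∈ X
  mem_neighbor : ∀ k, p k ∈ X
  le : ∀ i, ∀ x ∈ X, g i x ≤ g i u
  tight : ∀ i k, i ≠ k → g i (p k) = g i u
  lt : ∀ i, g i (p i) < g i u

/-- The face of `X` on which `l` takes the value it has at `u`. -/
def levelFace (X : Set E) (u : E) (l : E →L[ℝ] ℝ) : Set E := {x ∈ X | l x = l u}

namespace IsSimpleVertex

variable {ι : Type*} {X : Set E} {u : E} {g : ι → E →L[ℝ] ℝ} {p : ι → E}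

theorem apply_sub_of_ne (h : IsSimpleVertex X u g p) {i k : ι} (hik : i ≠ k) :
    g i (p k - u) = 0 := by
  rw [map_sub, h.tight i k hik, sub_self]

theorem apply_sub_self_ne (h : IsSimpleVertex X u g p) (i : ι) : g i (p i - u) ≠ 0 := by
  rw [map_sub]
  exact (sub_neg.2 (h.lt i)).ne

/-- The matrix `g i (p k - u)` is diagonal with nonzero diagonal, so `g i` reads off the `i`-th
coordinate in the system `p k - u`. -/
theorem apply_sum [Fintype ι] (h : IsSimpleVertex X u g p) (a : ι → ℝ) (i : ι) :
    g i (∑ k, a k • (p k - u)) = a i * g i (p i - u) := by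
  rw [map_sum, Finset.sum_eq_single i]
  · simp
  · intro k _ hk
    rw [map_smul, h.apply_sub_of_ne hk.symm, smul_zero]
  · simp

theorem linearIndependent [Fintype ι] (h : IsSimpleVertex X u g p) :
    LinearIndependent ℝ fun k => p k - u := by
  rw [Fintype.linearIndependent_iff]
  intro a ha i
  have := h.apply_sum a i
  rw [ha, map_zero] at this
  exact (mul_eq_zero.1 this.symm).resolve_right (h.apply_sub_self_ne i)

theorem span_eq_top [FiniteDimensional ℝ E] [Fintype ι] (h : IsSimpleVertex X u g p)
    (hcard : Fintype.card ι = Module.finrank ℝ E) :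
    Submodule.span ℝ (Set.range fun k => p k - u) = ⊤ :=
  h.linearIndependent.span_eq_top_of_card_eq_finrank' hcard

theorem exists_eq_sum [FiniteDimensional ℝ E] [Fintype ι] (h : IsSimpleVertex X u g p)
    (hcard : Fintype.card ι = Module.finrank ℝ E) (x : E) :
    ∃ a : ι → ℝ, ∑ k, a k • (p k - u) = x := by
  have hx : x ∈ Submodule.span ℝ (Set.range fun k => p k - u) := by
    rw [h.span_eq_top hcard]
    trivial
  exact (Submodule.mem_span_range_iff_exists_fun ℝ).1 hx

theorem vectorSpan_eq_top [FiniteDimensional ℝ E] [Fintype ι] (h : IsSimpleVertex X u g p)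
    (hcard : Fintype.card ι = Module.finrank ℝ E) : vectorSpan ℝ X = ⊤ := by
  rw [eq_top_iff, ← h.span_eq_top hcard, Submodule.span_le]
  rintro _ ⟨k, rfl⟩
  exact vsub_mem_vectorSpan ℝ (h.mem_neighbor k) h.mem

theorem mem_levelFace (h : IsSimpleVertex X u g p) (i : ι) : u ∈ levelFace X u (g i) :=
  ⟨h.mem, rfl⟩

/-- The kernel of `g i` is spanned by the differences `p k - u` with `k ≠ i`, and all of these are
directions of the face. -/
theorem isFacet_levelFace [FiniteDimensional ℝ E] [Fintype ι] (h : IsSimpleVertex X u g p)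
    (hcard : Fintype.card ι = Module.finrank ℝ E) (i : ι) :
    IsFacet X (levelFace X u (g i)) := by
  refine ⟨fun _ => ⟨g i, ?_⟩, ⟨u, h.mem_levelFace i⟩, ?_⟩
  · ext x
    refine and_congr_right fun hx => ⟨fun hxu y hy => hxu ▸ h.le i y hy, fun hmax => ?_⟩
    exact le_antisymm (h.le i x hx) (hmax u h.mem)
  · have hspan : vectorSpan ℝ (levelFace X u (g i)) =
        LinearMap.ker (g i : E →ₗ[ℝ] ℝ) := by
      refine le_antisymm (vectorSpan_le_ker_of_const fun x hx => hx.2) fun x hx => ?_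
      obtain ⟨a, rfl⟩ := h.exists_eq_sum hcard x
      have hai : a i = 0 := by
        have hx' : g i (∑ k, a k • (p k - u)) = 0 := hx
        rw [h.apply_sum] at hx'
        exact (mul_eq_zero.1 hx').resolve_right (h.apply_sub_self_ne i)
      refine Submodule.sum_mem _ fun k _ => ?_
      rcases eq_or_ne i k with rfl | hik
      · simp [hai]
      · exact Submodule.smul_mem _ _ (vsub_mem_vectorSpan ℝ
          (⟨h.mem_neighbor k, h.tight i k hik⟩ : p k ∈ levelFace X u (g i)) (h.mem_levelFace i))
    rw [hspan, h.vectorSpan_eq_top hcard, finrank_top]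
    refine Module.Dual.finrank_ker_add_one_of_ne_zero (f := (g i : E →ₗ[ℝ] ℝ)) fun h0 => ?_
    exact h.apply_sub_self_ne i (LinearMap.congr_fun h0 (p i - u))

theorem levelFace_injective (h : IsSimpleVertex X u g p) :
    Function.Injective fun i => levelFace X u (g i) := by
  intro i k hik
  by_contra hne
  have hmem : p i ∈ levelFace X u (g k) := ⟨h.mem_neighbor i, h.tight k i (Ne.symm hne)⟩
  have hik' : levelFace X u (g i) = levelFace X u (g k) := hik
  rw [← hik'] at hmem
  exact (h.lt i).ne hmem.2

theorem mem_extremePoints [FiniteDimensional ℝ E] [Fintype ι] (h : IsSimpleVertex X u g p)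
    (hcard : Fintype.card ι = Module.finrank ℝ E) : u ∈ X.extremePoints ℝ := by
  refine ⟨h.mem, fun x hx y hy hu => ?_⟩
  obtain ⟨a, b, ha, hb, hab, rfl⟩ := hu
  set u := a • x + b • y
  obtain ⟨c, hc⟩ := h.exists_eq_sum hcard (x - u)
  have hc0 : ∀ i, c i = 0 := by
    intro i
    have h1 := h.le i x hx
    have h2 := h.le i y hy
    have h3 : g i u = a * g i x + b * g i y := by simp [u]
    have h4 : g i x = g i u := by
      refine le_antisymm h1 ?_
      have h5 : a * (g i u - g i x) = b * (g i y - g i u) := by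
        linear_combination h3 + g i u * hab
      nlinarith [mul_nonneg hb.le (sub_nonneg.2 h2)]
    have h5 := h.apply_sum c i
    rw [hc, map_sub, h4, sub_self] at h5
    exact (mul_eq_zero.1 h5.symm).resolve_right (h.apply_sub_self_ne i)
  simp only [hc0, zero_smul, Finset.sum_const_zero] at hc
  exact (sub_eq_zero.1 hc.symm)

/-- The polytope lies in the cone at `u` spanned by the `p k - u`. A functional exposing `F` is
nonpositive on these generators and nonzero on some `p i - u`, so points of `F` have `i`-th
coordinate zero; hence `F` lies in the `i`-th facet and equals it. -/
theorem exists_eq_levelFace [FiniteDimensional ℝ E] [Fintype ι] (h : IsSimpleVertex X u g p)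
    (hcard : Fintype.card ι = Module.finrank ℝ E) {F : Set E} (hF : IsFacet X F) (hu : u ∈ F) :
    ∃ i, F = levelFace X u (g i) := by
  obtain ⟨l, hl⟩ := hF.1 hF.2.1
  have hle : ∀ y ∈ X, l y ≤ l u := by
    rw [hl] at hu
    exact hu.2
  by_cases hall : ∀ k, l (p k - u) = 0
  · exfalso
    have hl0 : ∀ x, l x = 0 := by
      intro x
      obtain ⟨a, rfl⟩ := h.exists_eq_sum hcard x
      simp [map_sum, map_smul, hall, -map_sub]
    have hFX : F = X := by
      rw [hl]
      ext x
      simp [hl0]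
    have := hF.2.2
    rw [hFX] at this
    omega
  · push Not at hall
    obtain ⟨i, hi⟩ := hall
    refine ⟨i, hF.eq_of_subset (h.isFacet_levelFace hcard i) fun x hx => ?_⟩
    rw [hl] at hx
    refine ⟨hx.1, ?_⟩
    have hlx : l x = l u := le_antisymm (hle x hx.1) (hx.2 u h.mem)
    obtain ⟨a, ha⟩ := h.exists_eq_sum hcard (x - u)
    have hneg : ∀ k, g k (p k - u) < 0 := fun k => by
      rw [map_sub]
      exact sub_neg.2 (h.lt k)
    have ha0 : ∀ k, 0 ≤ a k := by
      intro k
      have h1 := h.apply_sum a k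
      rw [ha, map_sub] at h1
      have h2 := h.le k x hx.1
      by_contra hlt
      have := mul_pos_of_neg_of_neg (not_le.1 hlt) (hneg k)
      linarith
    have hlp : ∀ k, l (p k - u) ≤ 0 := fun k => by
      rw [map_sub]
      exact sub_nonpos.2 (hle _ (h.mem_neighbor k))
    have hsum : ∑ k, a k * l (p k - u) = 0 := by
      have h1 := congrArg l ha
      rw [map_sum, map_sub, hlx, sub_self] at h1
      simpa only [map_smul, smul_eq_mul] using h1
    have hterm := (Finset.sum_eq_zero_iff_of_nonpos
      (fun k _ => mul_nonpos_of_nonneg_of_nonpos (ha0 k) (hlp k))).1 hsum i (Finset.mem_univ i)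
    have hai : a i = 0 := (mul_eq_zero.1 hterm).resolve_right hi
    have h1 := h.apply_sum a i
    rw [ha, hai, zero_mul, map_sub, sub_eq_zero] at h1
    exact h1

end IsSimpleVertex

/-- Over a convex hull, the maximisers of a functional lie in a hyperplane as soon as the
maximisers among the generating points do. -/
theorem apply_eq_of_mem_convexHull {s : Set E} {l m : E →L[ℝ] ℝ} {M c : ℝ}
    (hM : ∀ x ∈ s, l x ≤ M) (hm : ∀ x ∈ s, l x = M → m x = c) {z : E}
    (hz : z ∈ convexHull ℝ s) (hlz : l z = M) : m z = c := by
  have hsub : convexHull ℝ s ⊆ {x | l x ≤ M ∧ (l x = M → m x = c)} := by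
    refine convexHull_min (fun x hx => ⟨hM x hx, hm x hx⟩) ?_
    rw [convex_iff_forall_pos]
    rintro x ⟨hx, hx'⟩ y ⟨hy, hy'⟩ a b ha hb hab
    have hb' : b = 1 - a := by linarith
    simp only [Set.mem_ofPred_eq, map_add, map_smul, smul_eq_mul]
    refine ⟨by subst hb'; nlinarith, fun hl => ?_⟩
    have hlx : l x = M := by
      refine le_antisymm hx ?_
      by_contra hlt
      subst hb'
      nlinarith [mul_lt_mul_of_pos_left (not_le.1 hlt) ha, mul_le_mul_of_nonneg_left hy hb.le]
    have hly : l y = M := by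
      refine le_antisymm hy ?_
      by_contra hlt
      subst hb'
      nlinarith [mul_lt_mul_of_pos_left (not_le.1 hlt) hb, mul_le_mul_of_nonneg_left hx ha.le]
    rw [hx' hlx, hy' hly, hb']
    ring
  exact (hsub hz).2 hlz

end SimpleVertex

/-- The integral points whose convex hull is the grlex polytope of `θ`. -/
def IsGrlexFeasible {d : ℕ} (θ x : Fin d → ℤ) : Prop := (∀ i, 0 ≤ x i) ∧ GrlexLE x θ

/-- The value at `x` of the linear functional with coefficients `f`. -/
noncomputable def pairing {d : ℕ} (f : Fin d → ℝ) (x : Fin d → ℤ) : ℝ := ∑ i, f i * (x i : ℝ)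

/-! ### Integer functionals and moves of one unit. -/

section Pairing

variable {d : ℕ}

/-- The offset `m` is free: taking it to be one of the values of `f` removes that coordinate from
the sum. -/
theorem pairing_sub (f : Fin d → ℝ) (x y : Fin d → ℤ) (m : ℝ) :
    pairing f x - pairing f y =
      ∑ l, (f l - m) * ((x l : ℝ) - y l) + m * (((∑ l, x l : ℤ) : ℝ) - ((∑ l, y l : ℤ) : ℝ)) := by
  simp only [pairing]
  push_cast
  rw [← Finset.sum_sub_distrib, ← Finset.sum_sub_distrib, Finset.mul_sum,
    ← Finset.sum_add_distrib]
  exact Finset.sum_congr rfl fun l _ => by ring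

theorem pairing_sub_of_sum_eq (f : Fin d → ℝ) {x y : Fin d → ℤ} (m : ℝ)
    (h : ∑ l, x l = ∑ l, y l) :
    pairing f x - pairing f y = ∑ l, (f l - m) * ((x l : ℝ) - y l) := by
  rw [pairing_sub f x y m, h, sub_self, mul_zero, add_zero]

theorem pairing_add_const (f : Fin d → ℝ) (t : ℝ) (x : Fin d → ℤ) :
    pairing (fun l => f l + t) x = pairing f x + t * ((∑ l, x l : ℤ) : ℝ) := by
  simp only [pairing]
  push_cast
  rw [Finset.mul_sum, ← Finset.sum_add_distrib]
  exact Finset.sum_congr rfl fun l _ => by ring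

/-- Move one unit from coordinate `b` to coordinate `a`. -/
def moveUnit (x : Fin d → ℤ) (a b : Fin d) : Fin d → ℤ :=
  fun l => x l + (if l = a then 1 else 0) - (if l = b then 1 else 0)

theorem sum_moveUnit (x : Fin d → ℤ) (a b : Fin d) : ∑ l, moveUnit x a b l = ∑ l, x l := by
  simp [moveUnit, Finset.sum_add_distrib, Finset.sum_sub_distrib]

theorem pairing_moveUnit (f : Fin d → ℝ) (x : Fin d → ℤ) (a b : Fin d) :
    pairing f (moveUnit x a b) = pairing f x + f a - f b := by
  simp [pairing, moveUnit, mul_add, mul_sub, Finset.sum_add_distrib, Finset.sum_sub_distrib]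

theorem moveUnit_nonneg {x : Fin d → ℤ} (hx : ∀ i, 0 ≤ x i) {a b : Fin d} (hb : 0 < x b)
    (l : Fin d) : 0 ≤ moveUnit x a b l := by
  have := hx l
  unfold moveUnit
  rcases eq_or_ne l b with rfl | h
  · simp only [if_true]
    split_ifs <;> omega
  · simp only [h, if_false]
    split_ifs <;> omega

end Pairing

namespace IsGrlexFeasible

variable {d : ℕ} {θ x : Fin d → ℤ}

theorem of_sum_lt (hx : ∀ i, 0 ≤ x i) (h : ∑ i, x i < ∑ i, θ i) : IsGrlexFeasible θ x :=
  ⟨hx, Or.inl h⟩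

theorem of_lt (hx : ∀ i, 0 ≤ x i) (h : ∑ i, x i = ∑ i, θ i) (i : Fin d) (hi : x i < θ i)
    (hgt : ∀ k, i < k → x k = θ k) : IsGrlexFeasible θ x :=
  ⟨hx, Or.inr ⟨h, Or.inr ⟨i, hi, hgt⟩⟩⟩

theorem refl (hθ : ∀ i, 0 ≤ θ i) : IsGrlexFeasible θ θ :=
  ⟨hθ, Or.inr ⟨rfl, Or.inl rfl⟩⟩

theorem sum_le (h : IsGrlexFeasible θ x) : ∑ i, x i ≤ ∑ i, θ i := by
  rcases h.2 with h | h
  · exact h.le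
  · exact h.1.le

/-- Strictly below the top layer only nonnegativity constrains a move, since moves preserve the sum.
-/
theorem moveUnit_of_sum_lt (hx : ∀ i, 0 ≤ x i) (h : ∑ i, x i < ∑ i, θ i) {a b : Fin d}
    (hb : 0 < x b) : IsGrlexFeasible θ (moveUnit x a b) :=
  of_sum_lt (moveUnit_nonneg hx hb) (by rwa [sum_moveUnit])

/-- A move strictly below the deciding coordinate `i` leaves the lexicographic comparison untouched.
-/
theorem moveUnit_of_lt (hx : ∀ i, 0 ≤ x i) (h : ∑ i, x i = ∑ i, θ i) {i a b : Fin d}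
    (hi : x i < θ i) (hgt : ∀ k, i < k → x k = θ k) (ha : a < i) (hb' : b < i) (hb : 0 < x b) :
    IsGrlexFeasible θ (moveUnit x a b) := by
  refine of_lt (moveUnit_nonneg hx hb) (by rwa [sum_moveUnit]) i ?_ fun k hk => ?_
  · simpa [moveUnit, ha.ne', hb'.ne'] using hi
  · simpa [moveUnit, (ha.trans hk).ne', (hb'.trans hk).ne'] using hgt k hk

end IsGrlexFeasible

/-! ### Every facet that misses `θ` lies in a coordinate hyperplane. -/

section Cover

variable {n : ℕ}

/-- The point that agrees with `θ` above `k` and has the rest of its mass at `j`. -/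
def concentrate (θ : Fin (n + 1) → ℤ) (k j : Fin (n + 1)) : Fin (n + 1) → ℤ :=
  fun l => (if k < l then θ l else 0) + (if l = j then ∑ l, if k < l then 0 else θ l else 0)

theorem sum_concentrate (θ : Fin (n + 1) → ℤ) (k j : Fin (n + 1)) :
    ∑ l, concentrate θ k j l = ∑ l, θ l := by
  simp only [concentrate, Finset.sum_add_distrib, Finset.sum_ite_eq', Finset.mem_univ, if_true]
  rw [← Finset.sum_add_distrib]
  exact Finset.sum_congr rfl fun l _ => by split_ifs <;> simp

theorem concentrate_of_lt (θ : Fin (n + 1) → ℤ) {k j l : Fin (n + 1)} (hj : j ≤ k) (hl : k < l) :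
    concentrate θ k j l = θ l := by
  simp [concentrate, hl, (hj.trans_lt hl).ne']

theorem concentrate_of_le_of_ne (θ : Fin (n + 1) → ℤ) {k j l : Fin (n + 1)} (hl : l ≤ k)
    (hlj : l ≠ j) : concentrate θ k j l = 0 := by
  simp [concentrate, hl.not_gt, hlj]

theorem concentrate_nonneg {θ : Fin (n + 1) → ℤ} (hθ : ∀ i, 0 ≤ θ i) (k j l : Fin (n + 1)) :
    0 ≤ concentrate θ k j l := by
  refine add_nonneg ?_ ?_
  · split_ifs
    exacts [hθ l, le_rfl]
  · split_ifs
    · exact Finset.sum_nonneg fun l _ => by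
        split_ifs
        exacts [le_rfl, hθ l]
    · exact le_rfl

theorem concentrate_zero (θ : Fin (n + 1) → ℤ) : concentrate θ 0 0 = θ := by
  funext l
  refine Fin.cases ?_ (fun l => ?_) l
  · simp [concentrate, Fin.sum_univ_succ]
  · exact concentrate_of_lt θ le_rfl (Fin.succ_pos l)

/-- For `j < k` the coordinate `k` drops to zero and decides the comparison; for `k = j = 0` the
point is `θ` itself. -/
theorem isGrlexFeasible_concentrate {θ : Fin (n + 1) → ℤ} (hθ : ∀ i, 1 ≤ θ i)
    {k j : Fin (n + 1)} (hj : j < k ∨ k = 0 ∧ j = 0) :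
    IsGrlexFeasible θ (concentrate θ k j) := by
  have hθ0 : ∀ i, 0 ≤ θ i := fun i => zero_le_one.trans (hθ i)
  rcases hj with hj | ⟨rfl, rfl⟩
  · refine .of_lt (concentrate_nonneg hθ0 k j) (sum_concentrate θ k j) k ?_
      fun l hl => concentrate_of_lt θ hj.le hl
    rw [concentrate_of_le_of_ne θ le_rfl hj.ne']
    exact hθ k
  · rw [concentrate_zero]
    exact .refl hθ0

/-- Concentrating the mass below `k` at an index where `f` is largest does not decrease any term. -/
theorem concentrate_term_nonneg {θ x : Fin (n + 1) → ℤ} (hx : ∀ i, 0 ≤ x i) {f : Fin (n + 1) → ℝ}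
    {k j l : Fin (n + 1)} (hmax : ∀ l ≤ k, f l ≤ f j) (hl : l ≤ k) :
    0 ≤ (f l - f j) * ((concentrate θ k j l : ℝ) - x l) := by
  rcases eq_or_ne l j with rfl | hlj
  · simp
  · rw [concentrate_of_le_of_ne θ hl hlj]
    have h1 : (0 : ℝ) ≤ x l := by exact_mod_cast hx l
    have h2 := hmax l hl
    push_cast
    nlinarith

/-- If `f` is strictly increasing above `k` and largest at `j` below `k`, and its feasible maximisers
do not all lie in one coordinate hyperplane, then its maximum is attained at `θ`. -/
theorem pairing_eq_of_strict_above {θ : Fin (n + 1) → ℤ} (hθ : ∀ i, 1 ≤ θ i)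
    {f : Fin (n + 1) → ℝ} (hf : ∀ i, 0 ≤ f i) {M : ℝ}
    (hM : ∀ x, IsGrlexFeasible θ x → pairing f x ≤ M)
    (hcov : ∀ i, ∃ x, IsGrlexFeasible θ x ∧ pairing f x = M ∧ 0 < x i)
    {k j : Fin (n + 1)} (hstrict : ∀ i, k < i → ∀ l < i, f l < f i)
    (hj : j < k ∨ k = 0 ∧ j = 0) (hmax : ∀ l ≤ k, f l ≤ f j) : pairing f θ = M := by
  by_cases h0 : ∀ l, f l = 0
  · obtain ⟨x, -, hx, -⟩ := hcov 0
    rw [← hx]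
    simp [pairing, h0]
  have hjk : j ≤ k := by
    rcases hj with hj | ⟨rfl, rfl⟩
    exacts [hj.le, le_rfl]
  set c := concentrate θ k j with hc
  have hcM : pairing f c ≤ M := hM c (isGrlexFeasible_concentrate hθ hj)
  -- A maximiser with mass at or below `k` has full sum and agrees with `θ` above `k`; otherwise a
  -- unit move or the point `c` would do strictly better.
  have key : ∀ x, IsGrlexFeasible θ x → pairing f x = M → ∀ l ≤ k, 0 < x l →
      ∑ i, x i = ∑ i, θ i ∧ ∀ i, k < i → x i = θ i := by
    intro x hxf hxM l hlk hxl
    have hx := hxf.1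
    have hmove : ∀ a, IsGrlexFeasible θ (moveUnit x a l) → f a ≤ f l := by
      intro a ha
      have := hM _ ha
      rw [pairing_moveUnit] at this
      linarith
    rcases hxf.2 with hlt | ⟨hsum, rfl | ⟨i, hi, hgt⟩⟩
    · exfalso
      rcases (Fin.le_last k).eq_or_lt with hk | hk
      · have hpos : (0 : ℝ) < ((∑ l, c l : ℤ) : ℝ) - ((∑ l, x l : ℤ) : ℝ) := by
          rw [hc, sum_concentrate, sub_pos]
          exact_mod_cast hlt
        have hnn : 0 ≤ ∑ l, (f l - f j) * ((c l : ℝ) - x l) :=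
          Finset.sum_nonneg fun l _ => concentrate_term_nonneg hx hmax (hk ▸ Fin.le_last l)
        have heq := pairing_sub f c x (f j)
        refine h0 fun l => le_antisymm ?_ (hf l)
        have h1 := hmax l (hk ▸ Fin.le_last l)
        by_contra hfl
        have : 0 < f j * (((∑ l, c l : ℤ) : ℝ) - ((∑ l, x l : ℤ) : ℝ)) :=
          mul_pos (by linarith) hpos
        linarith
      · exact (hstrict _ hk l (hlk.trans_lt hk)).not_ge
          (hmove _ (.moveUnit_of_sum_lt hx hlt hxl))
    · exact ⟨rfl, fun _ _ => rfl⟩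
    · refine ⟨hsum, fun m hm => ?_⟩
      by_cases hik : i ≤ k
      · exact hgt m (hik.trans_lt hm)
      exfalso
      rw [not_le] at hik
      obtain ⟨a, rfl⟩ : ∃ a : Fin n, i = a.succ :=
        ⟨i.pred (Fin.ne_zero_of_lt hik), (Fin.succ_pred i _).symm⟩
      have hai : a.castSucc < a.succ := Fin.castSucc_lt_succ
      have hka : k ≤ a.castSucc := Fin.le_castSucc_iff.2 hik
      -- If the deciding index is `k + 1`, no index lies strictly between it and `k` to receive a
      -- unit, so `x` is compared with `c`; otherwise a unit moves up to the index just below the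
      -- deciding one.
      rcases hka.eq_or_lt with hka | hka
      · have heq := pairing_sub_of_sum_eq f (f j) (x := c) (y := x)
          (by rw [hc, sum_concentrate, hsum])
        have hpos : 0 < ∑ l, (f l - f j) * ((c l : ℝ) - x l) := by
          have hterm : 0 < (f a.succ - f j) * ((c a.succ : ℝ) - x a.succ) := by
            refine mul_pos (sub_pos.2 (hstrict _ hik j (hjk.trans_lt hik))) ?_
            rw [hc, concentrate_of_lt θ hjk hik, sub_pos]
            exact_mod_cast hi
          refine Finset.sum_pos' (fun l _ => ?_) ⟨a.succ, Finset.mem_univ _, hterm⟩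
          rcases le_or_gt l k with hl | hl
          · exact concentrate_term_nonneg hx hmax hl
          · rcases (show a.succ ≤ l from by
              rw [hka] at hl
              exact Fin.castSucc_lt_iff_succ_le.1 hl).eq_or_lt with rfl | hl'
            · exact hterm.le
            · rw [hc, concentrate_of_lt θ hjk hl, hgt l hl', sub_self, mul_zero]
        linarith
      · exact (hstrict _ hka l (hlk.trans_lt hka)).not_ge (hmove _
          (.moveUnit_of_lt hx hsum hi hgt hai ((hlk.trans_lt hka).trans hai) hxl))
  -- `c` is at least as good as `x` term by term, and `x` is maximal, so every term vanishes; the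
  -- term at `l`, where `x` has mass and `c` has none unless `l = j`, gives the equality.
  have hconst : ∀ l ≤ k, f l = f j := by
    intro l hl
    obtain ⟨x, hxf, hxM, hxl⟩ := hcov l
    obtain ⟨hsum, hagree⟩ := key x hxf hxM l hl hxl
    have heq := pairing_sub_of_sum_eq f (f j) (x := c) (y := x)
      (by rw [hc, sum_concentrate, hsum])
    have hnn : ∀ i ∈ Finset.univ, 0 ≤ (f i - f j) * ((c i : ℝ) - x i) := by
      intro i _
      rcases le_or_gt i k with hi | hi
      · exact concentrate_term_nonneg hxf.1 hmax hi
      · rw [hc, concentrate_of_lt θ hjk hi, hagree i hi, sub_self, mul_zero]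
    have hz := (Finset.sum_eq_zero_iff_of_nonneg hnn).1
      (le_antisymm (by linarith) (Finset.sum_nonneg hnn)) l (Finset.mem_univ l)
    rcases eq_or_ne l j with rfl | hlj
    · rfl
    · rw [hc, concentrate_of_le_of_ne θ hl hlj] at hz
      have hxl' : (0 : ℝ) < x l := by exact_mod_cast hxl
      rcases mul_eq_zero.1 hz with h | h
      · linarith
      · push_cast at h
        linarith
  obtain ⟨x, hxf, hxM, hxj⟩ := hcov j
  obtain ⟨hsum, hagree⟩ := key x hxf hxM j hjk hxj
  have heq := pairing_sub_of_sum_eq f (f j) hsum.symm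
  rw [Finset.sum_eq_zero fun l _ => ?_] at heq
  · linarith
  · rcases le_or_gt l k with hl | hl
    · rw [hconst l hl, sub_self, zero_mul]
    · rw [hagree l hl, sub_self, mul_zero]

/-- A functional whose feasible maximisers do not all lie in one coordinate hyperplane attains its
maximum at `θ`. -/
theorem pairing_eq_of_cover {θ : Fin (n + 1) → ℤ} (hθ : ∀ i, 1 ≤ θ i) {f : Fin (n + 1) → ℝ}
    {M : ℝ} (hM : ∀ x, IsGrlexFeasible θ x → pairing f x ≤ M)
    (hcov : ∀ i, ∃ x, IsGrlexFeasible θ x ∧ pairing f x = M ∧ 0 < x i) : pairing f θ = M := by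
  have hf : ∀ i, 0 ≤ f i := by
    intro i
    obtain ⟨x, hxf, hxM, hxi⟩ := hcov i
    -- Removing a unit keeps a maximiser feasible, so no coefficient is negative.
    have hy : IsGrlexFeasible θ fun l => x l - if l = i then 1 else 0 := by
      refine .of_sum_lt (fun l => ?_) ?_
      · have := hxf.1 l
        split_ifs with h
        · subst h
          omega
        · omega
      · have := hxf.sum_le
        rw [Finset.sum_sub_distrib, Finset.sum_ite_eq']
        simp only [Finset.mem_univ, if_true]
        omega
    have h1 := hM _ hy
    have h2 : pairing f (fun l => x l - if l = i then 1 else 0) = pairing f x - f i := by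
      simp [pairing, mul_sub, Finset.sum_sub_distrib]
    linarith
  by_contra hne
  -- Downward induction: at the first failure of strict growth from the top, the largest coefficient
  -- below `k` also dominates `f k`, and the previous result applies.
  have hstrict : ∀ k : Fin (n + 1), ∀ l < k, f l < f k := by
    intro k
    induction k using WellFoundedGT.induction with
    | ind k ih =>
      by_contra! hcon
      obtain ⟨l, hl, hfl⟩ := hcon
      obtain ⟨j, hj, hjmax⟩ := Finset.exists_max_image (Finset.Iio k) f ⟨l, Finset.mem_Iio.2 hl⟩
      refine hne (pairing_eq_of_strict_above hθ hf hM hcov ih (Or.inl (Finset.mem_Iio.1 hj))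
        fun m hm => ?_)
      rcases hm.eq_or_lt with rfl | hm
      · exact hfl.trans (hjmax l (Finset.mem_Iio.2 hl))
      · exact hjmax m (Finset.mem_Iio.2 hm)
  refine hne (pairing_eq_of_strict_above hθ hf hM hcov (k := 0) (j := 0)
    (fun i _ => hstrict i) (Or.inr ⟨rfl, rfl⟩) fun l hl => ?_)
  rw [Fin.le_zero_iff.1 hl]

end Cover

/-! ### The neighbours of `θ` and the facet normals there. -/

section UpperFacets

variable {n : ℕ}

/-- The neighbours of `θ` in the grlex polytope. -/
def grlexNeighbor (θ : Fin (n + 1) → ℤ) : Fin (n + 1) → Fin (n + 1) → ℤ :=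
  Fin.cases (fun l => if l = Fin.last n then ∑ i, θ i - 1 else 0)
    (fun k l => (if k.succ < l then θ l else 0) + (if l = k.succ then θ k.succ - 1 else 0) +
      (if l = k.castSucc then 1 + ∑ i, if i < k.succ then θ i else 0 else 0))

theorem grlexNeighbor_zero (θ : Fin (n + 1) → ℤ) (l : Fin (n + 1)) :
    grlexNeighbor θ 0 l = if l = Fin.last n then ∑ i, θ i - 1 else 0 := rfl

theorem grlexNeighbor_succ (θ : Fin (n + 1) → ℤ) (k : Fin n) (l : Fin (n + 1)) :
    grlexNeighbor θ k.succ l =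
      (if k.succ < l then θ l else 0) + (if l = k.succ then θ k.succ - 1 else 0) +
      (if l = k.castSucc then 1 + ∑ i, if i < k.succ then θ i else 0 else 0) := rfl

theorem grlexNeighbor_succ_of_lt (θ : Fin (n + 1) → ℤ) {k : Fin n} {l : Fin (n + 1)}
    (h : k.succ < l) : grlexNeighbor θ k.succ l = θ l := by
  simp [grlexNeighbor_succ, h, h.ne', (Fin.castSucc_lt_succ.trans h).ne']

theorem grlexNeighbor_succ_self (θ : Fin (n + 1) → ℤ) (k : Fin n) :
    grlexNeighbor θ k.succ k.succ = θ k.succ - 1 := by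
  simp [grlexNeighbor_succ, (Fin.castSucc_lt_succ (i := k)).ne']

theorem grlexNeighbor_succ_of_gt (θ : Fin (n + 1) → ℤ) {k : Fin n} {l : Fin (n + 1)}
    (h : l < k.succ) (hne : l ≠ k.castSucc) : grlexNeighbor θ k.succ l = 0 := by
  simp [grlexNeighbor_succ, h.not_gt, h.ne, hne]

theorem sum_grlexNeighbor_zero (θ : Fin (n + 1) → ℤ) :
    ∑ l, grlexNeighbor θ 0 l = ∑ l, θ l - 1 := by
  simp [grlexNeighbor_zero]

theorem sum_grlexNeighbor_succ (θ : Fin (n + 1) → ℤ) (k : Fin n) :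
    ∑ l, grlexNeighbor θ k.succ l = ∑ l, θ l := by
  simp only [grlexNeighbor_succ, Finset.sum_add_distrib, Finset.sum_ite_eq', Finset.mem_univ,
    if_true]
  have : ∑ l, θ l = ∑ l, (if k.succ < l then θ l else 0) + ∑ l, (if l = k.succ then θ l else 0) +
      ∑ l, if l < k.succ then θ l else 0 := by
    rw [← Finset.sum_add_distrib, ← Finset.sum_add_distrib]
    refine Finset.sum_congr rfl fun l _ => ?_
    rcases lt_trichotomy l k.succ with h | h | h
    · simp [h, h.ne, h.not_gt]
    · simp [h]
    · simp [h, h.ne', h.not_gt]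
  rw [this, Finset.sum_ite_eq' Finset.univ k.succ θ]
  simp only [Finset.mem_univ, if_true]
  ring

theorem isGrlexFeasible_grlexNeighbor {θ : Fin (n + 1) → ℤ} (hθ : ∀ i, 1 ≤ θ i)
    (k : Fin (n + 1)) : IsGrlexFeasible θ (grlexNeighbor θ k) := by
  have hθ0 : ∀ i, 0 ≤ θ i := fun i => zero_le_one.trans (hθ i)
  refine Fin.cases ?_ (fun k => ?_) k
  · refine .of_sum_lt (fun l => ?_) (by rw [sum_grlexNeighbor_zero]; omega)
    rw [grlexNeighbor_zero]
    have := Finset.single_le_sum (fun i _ => hθ0 i) (Finset.mem_univ l)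
    have := hθ l
    split_ifs <;> omega
  · refine .of_lt (fun l => ?_) (sum_grlexNeighbor_succ θ k) k.succ
      (by rw [grlexNeighbor_succ_self]; omega) fun l hl => grlexNeighbor_succ_of_lt θ hl
    rw [grlexNeighbor_succ]
    have h1 : 0 ≤ ∑ i, if i < k.succ then θ i else 0 :=
      Finset.sum_nonneg fun i _ => by
        split_ifs
        exacts [hθ0 i, le_rfl]
    have h2 := hθ l
    have h3 := hθ k.succ
    split_ifs <;> omega

theorem pairing_grlexNeighbor_zero (θ : Fin (n + 1) → ℤ) (f : Fin (n + 1) → ℝ) :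
    pairing f (grlexNeighbor θ 0) = f (Fin.last n) * (((∑ i, θ i : ℤ) : ℝ) - 1) := by
  simp [pairing, grlexNeighbor_zero]

/-- The offset `f k.castSucc` kills the coordinate holding the collected mass. Setting the right
side to zero is the recursion that defines `facetBase`. -/
theorem pairing_sub_grlexNeighbor_succ (θ : Fin (n + 1) → ℤ) (f : Fin (n + 1) → ℝ) (k : Fin n) :
    pairing f θ - pairing f (grlexNeighbor θ k.succ) =
      f k.succ - f k.castSucc -
        ∑ l, if l < k.succ then (θ l : ℝ) * (f k.castSucc - f l) else 0 := by
  rw [pairing_sub_of_sum_eq f (f k.castSucc) (sum_grlexNeighbor_succ θ k).symm]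
  have : f k.succ - f k.castSucc =
      ∑ l, if l = k.succ then f k.succ - f k.castSucc else 0 := by simp
  rw [this, ← Finset.sum_sub_distrib]
  refine Finset.sum_congr rfl fun l _ => ?_
  rcases lt_trichotomy l k.succ with h | rfl | h
  · rcases eq_or_ne l k.castSucc with rfl | hne
    · simp [h.ne]
    · simp only [grlexNeighbor_succ_of_gt θ h hne, h, h.ne, if_true, if_false]
      push_cast
      ring
  · simp [grlexNeighbor_succ_self]
  · simp [grlexNeighbor_succ_of_lt θ h, h.ne', h.not_gt]

/-- A nonnegative monotone functional that does not increase from `θ` to its neighbours is maximal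
at `θ` over all feasible points. -/
theorem pairing_le_of_monotone {θ x : Fin (n + 1) → ℤ} {f : Fin (n + 1) → ℝ}
    (hf0 : ∀ l, 0 ≤ f l) (hf : Monotone f)
    (hnb : ∀ k, pairing f (grlexNeighbor θ k) ≤ pairing f θ) (hx : IsGrlexFeasible θ x) :
    pairing f x ≤ pairing f θ := by
  rcases hx.2 with hlt | ⟨hsum, rfl | ⟨i, hi, hgt⟩⟩
  -- Each unit is worth at most the last coefficient, and there are at most `S - 1` units.
  · refine le_trans ?_ (hnb 0)
    rw [pairing_grlexNeighbor_zero]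
    have h1 : ((∑ l, x l : ℤ) : ℝ) ≤ ((∑ l, θ l : ℤ) : ℝ) - 1 := by
      have : ∑ l, x l ≤ ∑ l, θ l - 1 := by omega
      exact_mod_cast this
    refine le_trans ?_ (mul_le_mul_of_nonneg_left h1 (hf0 _))
    push_cast
    rw [Finset.mul_sum]
    exact Finset.sum_le_sum fun l _ =>
      mul_le_mul_of_nonneg_right (hf (Fin.le_last l)) (by exact_mod_cast hx.1 l)
  · exact le_rfl
  · induction i using Fin.cases with
    | zero =>
      -- Equal sums and agreement above index `0` force agreement at `0`.
      exfalso
      rw [Fin.sum_univ_succ, Fin.sum_univ_succ,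
        Finset.sum_congr rfl fun l _ => hgt (Fin.succ l) (Fin.succ_pos l)] at hsum
      omega
    | succ k =>
      refine le_trans ?_ (hnb k.succ)
      rw [← sub_nonneg, pairing_sub_of_sum_eq f (f k.castSucc)
        ((sum_grlexNeighbor_succ θ k).trans hsum.symm)]
      refine Finset.sum_nonneg fun l _ => ?_
      rcases lt_trichotomy l k.succ with h | rfl | h
      · rcases eq_or_ne l k.castSucc with rfl | hne
        · simp
        · rw [grlexNeighbor_succ_of_gt θ h hne]
          have h1 : (0 : ℝ) ≤ x l := by exact_mod_cast hx.1 l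
          have h2 := hf (Fin.le_castSucc_iff.2 h)
          push_cast
          nlinarith
      · refine mul_nonneg (sub_nonneg.2 (hf Fin.castSucc_lt_succ.le)) ?_
        rw [grlexNeighbor_succ_self, sub_nonneg]
        exact_mod_cast (by omega : x k.succ ≤ θ k.succ - 1)
      · rw [grlexNeighbor_succ_of_lt θ h, hgt l h, sub_self, mul_zero]

/-- Up to a multiple of the coordinate sum, the coefficients of the `i`-th facet normal at `θ`. -/
noncomputable def facetBase {d : ℕ} (θ : Fin d → ℤ) (i k : Fin d) : ℝ :=
  if h : i < k then
    facetBase θ i ⟨k - 1, by omega⟩ +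
      ∑ j : {j : Fin d // j < k}, (θ j : ℝ) * (facetBase θ i ⟨k - 1, by omega⟩ - facetBase θ i j)
  else if k = i then 1 else 0
termination_by k.val
decreasing_by
  all_goals simp_wf
  all_goals omega

theorem facetBase_of_gt {d : ℕ} (θ : Fin d → ℤ) {i k : Fin d} (h : k < i) :
    facetBase θ i k = 0 := by
  rw [facetBase]
  simp [h.not_gt, h.ne]

theorem facetBase_self {d : ℕ} (θ : Fin d → ℤ) (i : Fin d) : facetBase θ i i = 1 := by
  rw [facetBase]
  simp

theorem facetBase_succ (θ : Fin (n + 1) → ℤ) {i : Fin (n + 1)} {k : Fin n} (h : i < k.succ) :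
    facetBase θ i k.succ = facetBase θ i k.castSucc +
      ∑ l, if l < k.succ then (θ l : ℝ) * (facetBase θ i k.castSucc - facetBase θ i l) else 0 := by
  have hk : ∀ h', (⟨(k.succ : ℕ) - 1, h'⟩ : Fin (n + 1)) = k.castSucc := fun _ => by
    ext
    simp
  rw [facetBase, dif_pos h]
  simp only [hk]
  congr 1
  rw [← Finset.sum_filter]
  exact (Finset.sum_subtype _ (by simp)
    fun l : Fin (n + 1) => (θ l : ℝ) * (facetBase θ i k.castSucc - facetBase θ i l)).symm

theorem facetBase_zero (θ : Fin (n + 1) → ℤ) (k : Fin (n + 1)) : facetBase θ 0 k = 1 := by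
  suffices ∀ j ≤ k, facetBase θ 0 j = 1 from this k le_rfl
  induction k using Fin.induction with
  | zero =>
    intro j hj
    rw [Fin.le_zero_iff.1 hj, facetBase_self]
  | succ k ih =>
    intro j hj
    rcases hj.eq_or_lt with rfl | hj
    · rw [facetBase_succ θ (Fin.succ_pos k), ih _ le_rfl, Finset.sum_eq_zero, add_zero]
      intro l _
      split_ifs with hl
      · rw [ih l (Fin.le_castSucc_iff.2 hl), sub_self, mul_zero]
      · rfl
    · exact ih j (Fin.le_castSucc_iff.2 hj)

theorem facetBase_monotone {θ : Fin (n + 1) → ℤ} (hθ : ∀ i, 0 ≤ θ i) (i : Fin (n + 1)) :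
    Monotone (facetBase θ i) := by
  suffices ∀ k, ∀ j ≤ k, facetBase θ i j ≤ facetBase θ i k from fun j k => this k j
  intro k
  induction k using Fin.induction with
  | zero =>
    intro j hj
    rw [Fin.le_zero_iff.1 hj]
  | succ k ih =>
    intro j hj
    rcases hj.eq_or_lt with rfl | hj
    · exact le_rfl
    rcases lt_trichotomy k.succ i with h | rfl | h
    · rw [facetBase_of_gt θ h, facetBase_of_gt θ (hj.trans h)]
    · rw [facetBase_self, facetBase_of_gt θ hj]
      exact zero_le_one
    · refine (ih j (Fin.le_castSucc_iff.2 hj)).trans ?_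
      rw [facetBase_succ θ h]
      refine le_add_of_nonneg_right (Finset.sum_nonneg fun l _ => ?_)
      split_ifs with hl
      · exact mul_nonneg (by exact_mod_cast hθ l) (sub_nonneg.2 (ih l (Fin.le_castSucc_iff.2 hl)))
      · exact le_rfl

theorem facetBase_nonneg {θ : Fin (n + 1) → ℤ} (hθ : ∀ i, 0 ≤ θ i) (i k : Fin (n + 1)) :
    0 ≤ facetBase θ i k := by
  rcases lt_or_ge k i with h | h
  · rw [facetBase_of_gt θ h]
  · refine le_trans ?_ (facetBase_monotone hθ i h)
    rw [facetBase_self]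
    exact zero_le_one

/-- The multiple of the coordinate sum that makes the facet pass through `(S - 1) e_d`, where `S`
is the coordinate sum of `θ`. -/
noncomputable def facetShift (θ : Fin (n + 1) → ℤ) (i : Fin (n + 1)) : ℝ :=
  if i = 0 then 0 else
    (((∑ l, θ l : ℤ) : ℝ) - 1) * facetBase θ i (Fin.last n) - pairing (facetBase θ i) θ

/-- The coefficients of the `i`-th facet normal at `θ`. -/
noncomputable def facetCoeff (θ : Fin (n + 1) → ℤ) (i l : Fin (n + 1)) : ℝ :=
  facetBase θ i l + facetShift θ i

/-- For `i ≠ 0` the base coefficient at `0` vanishes, so monotonicity bounds the pairing with `θ` by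
the last coefficient times `S - θ 0`, and `θ 0 ≥ 1`. -/
theorem facetShift_nonneg {θ : Fin (n + 1) → ℤ} (hθ : ∀ i, 1 ≤ θ i) (i : Fin (n + 1)) :
    0 ≤ facetShift θ i := by
  have hθ0 : ∀ i, 0 ≤ θ i := fun i => zero_le_one.trans (hθ i)
  unfold facetShift
  split_ifs with hi
  · exact le_rfl
  · have hmono := facetBase_monotone hθ0 i
    have h0 : facetBase θ i 0 = 0 := facetBase_of_gt θ (Fin.pos_iff_ne_zero.2 hi)
    have hlast := facetBase_nonneg hθ0 i (Fin.last n)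
    have hle : pairing (facetBase θ i) θ ≤
        ∑ l : Fin n, facetBase θ i (Fin.last n) * (θ l.succ : ℝ) := by
      rw [pairing, Fin.sum_univ_succ, h0, zero_mul, zero_add]
      exact Finset.sum_le_sum fun l _ =>
        mul_le_mul_of_nonneg_right (hmono (Fin.le_last _)) (by exact_mod_cast hθ0 _)
    rw [← Finset.mul_sum] at hle
    have h1 : (1 : ℝ) ≤ θ 0 := by exact_mod_cast hθ 0
    rw [Fin.sum_univ_succ]
    push_cast
    nlinarith

theorem facetCoeff_monotone {θ : Fin (n + 1) → ℤ} (hθ : ∀ i, 0 ≤ θ i) (i : Fin (n + 1)) :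
    Monotone (facetCoeff θ i) := fun _ _ h => add_le_add_left (facetBase_monotone hθ i h) _

theorem facetCoeff_nonneg {θ : Fin (n + 1) → ℤ} (hθ : ∀ i, 1 ≤ θ i) (i k : Fin (n + 1)) :
    0 ≤ facetCoeff θ i k :=
  add_nonneg (facetBase_nonneg (fun i => zero_le_one.trans (hθ i)) i k) (facetShift_nonneg hθ i)

theorem facetCoeff_zero (θ : Fin (n + 1) → ℤ) : facetCoeff θ 0 = fun _ => 1 := by
  funext k
  simp [facetCoeff, facetShift, facetBase_zero]

theorem pairing_facetCoeff_zero (θ x : Fin (n + 1) → ℤ) :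
    pairing (facetCoeff θ 0) x = ((∑ l, x l : ℤ) : ℝ) := by
  simp [facetCoeff_zero, pairing]

theorem pairing_facetCoeff (θ : Fin (n + 1) → ℤ) (i : Fin (n + 1)) (x : Fin (n + 1) → ℤ) :
    pairing (facetCoeff θ i) x =
      pairing (facetBase θ i) x + facetShift θ i * ((∑ l, x l : ℤ) : ℝ) :=
  pairing_add_const _ _ _

/-- The shift cancels because these neighbours have the same sum as `θ`; what remains is the
recursion above `i`, the jump from 0 to 1 at `i`, and zeros below. -/
theorem pairing_facetCoeff_sub_succ (θ : Fin (n + 1) → ℤ) (i : Fin (n + 1)) (k : Fin n) :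
    pairing (facetCoeff θ i) θ - pairing (facetCoeff θ i) (grlexNeighbor θ k.succ) =
      if i = k.succ then 1 else 0 := by
  rw [pairing_facetCoeff, pairing_facetCoeff, sum_grlexNeighbor_succ, add_sub_add_right_eq_sub,
    pairing_sub_grlexNeighbor_succ]
  rcases lt_trichotomy k.succ i with h | rfl | h
  · have hz : ∀ l ≤ k.succ, facetBase θ i l = 0 := fun l hl => facetBase_of_gt θ (hl.trans_lt h)
    rw [hz _ le_rfl, hz _ Fin.castSucc_lt_succ.le, if_neg h.ne', Finset.sum_eq_zero, sub_self,
      sub_self]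
    intro l _
    split_ifs with hl
    · rw [hz l hl.le, sub_self, mul_zero]
    · rfl
  · have hz : ∀ l < k.succ, facetBase θ k.succ l = 0 := fun l hl => facetBase_of_gt θ hl
    rw [facetBase_self, hz _ Fin.castSucc_lt_succ, if_pos rfl, Finset.sum_eq_zero, sub_zero,
      sub_zero]
    intro l _
    split_ifs with hl
    · rw [hz l hl, sub_self, mul_zero]
    · rfl
  · rw [facetBase_succ θ h, if_neg h.ne]
    ring

theorem pairing_facetCoeff_tight (θ : Fin (n + 1) → ℤ) {i k : Fin (n + 1)} (h : i ≠ k) :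
    pairing (facetCoeff θ i) (grlexNeighbor θ k) = pairing (facetCoeff θ i) θ := by
  induction k using Fin.cases with
  | zero =>
    rw [pairing_facetCoeff, pairing_facetCoeff, sum_grlexNeighbor_zero, pairing_grlexNeighbor_zero,
      facetShift, if_neg h]
    push_cast
    ring
  | succ k =>
    have := pairing_facetCoeff_sub_succ θ i k
    rw [if_neg h] at this
    linarith

theorem pairing_facetCoeff_lt (θ : Fin (n + 1) → ℤ) (i : Fin (n + 1)) :
    pairing (facetCoeff θ i) (grlexNeighbor θ i) < pairing (facetCoeff θ i) θ := by
  induction i using Fin.cases with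
  | zero =>
    rw [pairing_facetCoeff_zero, pairing_facetCoeff_zero, sum_grlexNeighbor_zero]
    push_cast
    linarith
  | succ k =>
    have := pairing_facetCoeff_sub_succ θ k.succ k
    rw [if_pos rfl] at this
    linarith

theorem pairing_facetCoeff_le {θ : Fin (n + 1) → ℤ} (hθ : ∀ i, 1 ≤ θ i) (i : Fin (n + 1))
    {x : Fin (n + 1) → ℤ} (hx : IsGrlexFeasible θ x) :
    pairing (facetCoeff θ i) x ≤ pairing (facetCoeff θ i) θ := by
  refine pairing_le_of_monotone (facetCoeff_nonneg hθ i)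
    (facetCoeff_monotone (fun i => zero_le_one.trans (hθ i)) i) (fun k => ?_) hx
  rcases eq_or_ne i k with rfl | h
  · exact (pairing_facetCoeff_lt θ i).le
  · exact (pairing_facetCoeff_tight θ h).le

end UpperFacets

/-! ### The two simple vertices and the facet count. -/

section GrlexPolytope

variable {n : ℕ} {θ : Fin (n + 1) → ℤ}

/-- The linear functional on `ℝ^d` with coefficients `f`. -/
noncomputable def pairingCLM {d : ℕ} (f : Fin d → ℝ) : (Fin d → ℝ) →L[ℝ] ℝ :=
  ∑ i, f i • ContinuousLinearMap.proj i

theorem pairingCLM_intPoint {d : ℕ} (f : Fin d → ℝ) (x : Fin d → ℤ) :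
    pairingCLM f (intPoint x) = pairing f x := by
  simp [pairingCLM, pairing, intPoint]

theorem apply_intPoint {d : ℕ} (l : (Fin d → ℝ) →L[ℝ] ℝ) (x : Fin d → ℤ) :
    l (intPoint x) = pairing (fun i => l (Pi.single i 1)) x := by
  conv_lhs => rw [pi_eq_sum_univ' (intPoint x), map_sum]
  exact Finset.sum_congr rfl fun i _ => by simp [intPoint, mul_comm]

theorem grlexPolytope_eq {d : ℕ} (θ : Fin d → ℤ) :
    grlexPolytope θ = convexHull ℝ (intPoint '' {x | IsGrlexFeasible θ x}) := rfl

theorem IsGrlexFeasible.mem_grlexPolytope {d : ℕ} {θ x : Fin d → ℤ} (h : IsGrlexFeasible θ x) :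
    intPoint x ∈ grlexPolytope θ :=
  subset_convexHull ℝ _ ⟨x, h, rfl⟩

theorem apply_le_of_mem_grlexPolytope {d : ℕ} {θ : Fin d → ℤ} {l : (Fin d → ℝ) →L[ℝ] ℝ} {M : ℝ}
    (h : ∀ x, IsGrlexFeasible θ x → l (intPoint x) ≤ M) :
    ∀ z ∈ grlexPolytope θ, l z ≤ M := by
  refine convexHull_min ?_ (convex_halfSpace_le l.toLinearMap.isLinear M)
  rintro _ ⟨x, hx, rfl⟩
  exact h x hx

theorem intPoint_zero {d : ℕ} : intPoint (0 : Fin d → ℤ) = 0 := by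
  funext i
  simp [intPoint]

theorem intPoint_injective {d : ℕ} : Function.Injective (intPoint (d := d)) := by
  intro x y h
  funext i
  exact Int.cast_injective (congrFun h i)

/-- The facet normals at `0`. -/
noncomputable def negCoord {d : ℕ} (i : Fin d) : (Fin d → ℝ) →L[ℝ] ℝ :=
  -ContinuousLinearMap.proj i

theorem negCoord_apply {d : ℕ} (i : Fin d) (x : Fin d → ℝ) : negCoord i x = -x i := rfl

theorem finite_isGrlexFeasible {d : ℕ} (θ : Fin d → ℤ) : {x | IsGrlexFeasible θ x}.Finite := by
  refine (Set.finite_Icc (0 : Fin d → ℤ) fun _ => ∑ i, θ i).subset fun x hx => ?_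
  exact ⟨fun i => hx.1 i, fun i => (Finset.single_le_sum (fun j _ => hx.1 j)
    (Finset.mem_univ i)).trans hx.sum_le⟩

/-- Puts the unit vectors, of sum 1, strictly below the top layer. -/
theorem two_le_sum (hn : 1 ≤ n) (hθ : ∀ i, 1 ≤ θ i) : 2 ≤ ∑ i, θ i := by
  have h : (Finset.univ : Finset (Fin (n + 1))).card • (1 : ℤ) ≤ ∑ i, θ i :=
    Finset.card_nsmul_le_sum Finset.univ θ 1 fun i _ => hθ i
  simp only [Finset.card_univ, Fintype.card_fin, nsmul_eq_mul] at h
  push_cast at h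
  omega

theorem isSimpleVertex_zero (hn : 1 ≤ n) (hθ : ∀ i, 1 ≤ θ i) :
    IsSimpleVertex (grlexPolytope θ) 0 negCoord (fun k => intPoint (Pi.single k 1)) where
  mem := by
    rw [← intPoint_zero]
    have := two_le_sum hn hθ
    exact (IsGrlexFeasible.of_sum_lt (fun _ => le_rfl)
      (by simp; omega)).mem_grlexPolytope
  mem_neighbor k := by
    have := two_le_sum hn hθ
    refine (IsGrlexFeasible.of_sum_lt (fun i => ?_) (by simp; omega)).mem_grlexPolytope
    rw [Pi.single_apply]
    split_ifs <;> simp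
  le i := apply_le_of_mem_grlexPolytope fun x hx => by
    have : (0 : ℝ) ≤ x i := by exact_mod_cast hx.1 i
    simpa [negCoord_apply, intPoint] using this
  tight i k h := by simp [negCoord_apply, intPoint, h]
  lt i := by simp [negCoord_apply, intPoint]

theorem isSimpleVertex_intPoint (hθ : ∀ i, 1 ≤ θ i) :
    IsSimpleVertex (grlexPolytope θ) (intPoint θ) (fun i => pairingCLM (facetCoeff θ i))
      (fun k => intPoint (grlexNeighbor θ k)) where
  mem := (IsGrlexFeasible.refl fun i => zero_le_one.trans (hθ i)).mem_grlexPolytope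
  mem_neighbor k := (isGrlexFeasible_grlexNeighbor hθ k).mem_grlexPolytope
  le i := apply_le_of_mem_grlexPolytope fun x hx => by
    simpa only [pairingCLM_intPoint] using pairing_facetCoeff_le hθ i hx
  tight i k h := by simpa only [pairingCLM_intPoint] using pairing_facetCoeff_tight θ h
  lt i := by simpa only [pairingCLM_intPoint] using pairing_facetCoeff_lt θ i

theorem card_fin_eq_finrank {d : ℕ} :
    Fintype.card (Fin d) = Module.finrank ℝ (Fin d → ℝ) := by simp

/-- A facet that misses `θ` lies in a coordinate hyperplane. -/
theorem zero_mem_facet_or_intPoint_mem_facet (hn : 1 ≤ n) (hθ : ∀ i, 1 ≤ θ i)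
    {F : Set (Fin (n + 1) → ℝ)} (hF : IsFacet (grlexPolytope θ) F) :
    0 ∈ F ∨ intPoint θ ∈ F := by
  have hzero := isSimpleVertex_zero hn hθ
  obtain ⟨l, hl⟩ := hF.1 hF.2.1
  obtain ⟨z, hz⟩ := hF.2.1
  have hz' := hz
  rw [hl] at hz'
  have hMx : ∀ x, IsGrlexFeasible θ x → l (intPoint x) ≤ l z :=
    fun x hx => hz'.2 _ hx.mem_grlexPolytope
  by_cases hcov : ∀ i, ∃ x, IsGrlexFeasible θ x ∧ l (intPoint x) = l z ∧ 0 < x i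
  · right
    have hθM : l (intPoint θ) = l z := by
      simp only [apply_intPoint l (_ : Fin (n + 1) → ℤ)] at hcov hMx ⊢
      exact pairing_eq_of_cover hθ hMx hcov
    rw [hl]
    exact ⟨(isSimpleVertex_intPoint hθ).mem, fun y hy => hθM ▸ hz'.2 y hy⟩
  · left
    push Not at hcov
    obtain ⟨i, hi⟩ := hcov
    have hsub : F ⊆ levelFace (grlexPolytope θ) 0 (negCoord i) := by
      intro w hw
      rw [hl] at hw
      refine ⟨hw.1, ?_⟩
      rw [map_zero]
      refine apply_eq_of_mem_convexHull (l := l) (M := l z) ?_ ?_ hw.1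
        (le_antisymm (hz'.2 w hw.1) (hw.2 z hz'.1))
      · rintro _ ⟨x, hx, rfl⟩
        exact hMx x hx
      · rintro _ ⟨x, hx, rfl⟩ hlx
        have : x i = 0 := le_antisymm (hi x hx hlx) (hx.1 i)
        simp [negCoord_apply, intPoint, this]
    rw [hF.eq_of_subset (hzero.isFacet_levelFace card_fin_eq_finrank i) hsub]
    exact hzero.mem_levelFace i

theorem sum_facetCoeff_pos (hθ : ∀ i, 1 ≤ θ i) (i : Fin (n + 1)) :
    0 < pairing (facetCoeff θ i) θ := by
  have hθ0 : ∀ i, (0 : ℝ) < θ i := fun i => by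
    have := hθ i
    exact_mod_cast (by omega : 0 < θ i)
  refine Finset.sum_pos' (fun l _ => mul_nonneg (facetCoeff_nonneg hθ i l) (hθ0 l).le)
    ⟨i, Finset.mem_univ i, mul_pos ?_ (hθ0 i)⟩
  rw [facetCoeff, facetBase_self]
  linarith [facetShift_nonneg hθ i]

theorem zero_notMem_levelFace (hθ : ∀ i, 1 ≤ θ i) (i : Fin (n + 1)) :
    (0 : Fin (n + 1) → ℝ) ∉
      levelFace (grlexPolytope θ) (intPoint θ) (pairingCLM (facetCoeff θ i)) := by
  rintro ⟨-, h⟩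
  rw [map_zero, pairingCLM_intPoint] at h
  exact (sum_facetCoeff_pos hθ i).ne h

theorem not_zero_mem_and_intPoint_mem (hθ : ∀ i, 1 ≤ θ i)
    {F : Set (Fin (n + 1) → ℝ)} (hF : IsFacet (grlexPolytope θ) F) :
    ¬ (0 ∈ F ∧ intPoint θ ∈ F) := by
  rintro ⟨h0, h1⟩
  obtain ⟨i, rfl⟩ := (isSimpleVertex_intPoint hθ).exists_eq_levelFace card_fin_eq_finrank hF h1
  exact zero_notMem_levelFace hθ i h0

/-- The two families each have `n + 1` members, and are disjoint because `0` lies on every facet of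
the first and on none of the second. -/
theorem encard_facets (hn : 1 ≤ n) (hθ : ∀ i, 1 ≤ θ i) :
    {F | IsFacet (grlexPolytope θ) F}.encard = (2 * (n + 1) : ℕ) := by
  have hzero := isSimpleVertex_zero hn hθ
  have htop := isSimpleVertex_intPoint hθ
  have heq : {F | IsFacet (grlexPolytope θ) F} =
      Set.range (fun i => levelFace (grlexPolytope θ) 0 (negCoord i)) ∪
      Set.range (fun i => levelFace (grlexPolytope θ) (intPoint θ)
        (pairingCLM (facetCoeff θ i))) := by
    ext F
    constructor
    · intro hF
      rcases zero_mem_facet_or_intPoint_mem_facet hn hθ hF with h | h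
      · obtain ⟨i, rfl⟩ := hzero.exists_eq_levelFace card_fin_eq_finrank hF h
        exact Or.inl ⟨i, rfl⟩
      · obtain ⟨i, rfl⟩ := htop.exists_eq_levelFace card_fin_eq_finrank hF h
        exact Or.inr ⟨i, rfl⟩
    · rintro (⟨i, rfl⟩ | ⟨i, rfl⟩)
      · exact hzero.isFacet_levelFace card_fin_eq_finrank i
      · exact htop.isFacet_levelFace card_fin_eq_finrank i
  rw [heq, Set.encard_union_eq]
  · rw [← Set.image_univ, ← Set.image_univ, hzero.levelFace_injective.encard_image,
      htop.levelFace_injective.encard_image, Set.encard_univ, ENat.card_eq_coe_fintype_card,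
      Fintype.card_fin]
    push_cast
    ring
  · rw [Set.disjoint_left]
    rintro _ ⟨i, rfl⟩ ⟨k, hk⟩
    dsimp only at hk
    exact zero_notMem_levelFace hθ k (hk ▸ hzero.mem_levelFace i)

theorem isDPolytope_grlexPolytope (hn : 1 ≤ n) (hθ : ∀ i, 1 ≤ θ i) :
    IsDPolytope (n + 1) (grlexPolytope θ) := by
  refine ⟨⟨_, (finite_isGrlexFeasible θ).image _, ⟨_, θ, ?_, rfl⟩, grlexPolytope_eq θ⟩, ?_⟩
  · exact .refl fun i => zero_le_one.trans (hθ i)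
  · rw [(isSimpleVertex_zero hn hθ).vectorSpan_eq_top card_fin_eq_finrank, finrank_top]
    simp

theorem isAntipodalVertexPair_zero_intPoint (hn : 1 ≤ n) (hθ : ∀ i, 1 ≤ θ i) :
    IsAntipodalVertexPair (grlexPolytope θ) 0 (intPoint θ) := by
  refine ⟨(isSimpleVertex_zero hn hθ).mem_extremePoints card_fin_eq_finrank,
    (isSimpleVertex_intPoint hθ).mem_extremePoints card_fin_eq_finrank, fun h => ?_,
    fun F hF => not_zero_mem_and_intPoint_mem hθ hF⟩
  have h0 := congrFun h 0
  have := hθ 0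
  simp only [intPoint, Pi.zero_apply] at h0
  have h1 : θ 0 = 0 := by exact_mod_cast h0.symm
  omega

/-! ### The vertices of the grlex polytope -/

theorem exists_of_mem_extremePoints {d : ℕ} {θ : Fin d → ℤ} {u : Fin d → ℝ}
    (hu : u ∈ (grlexPolytope θ).extremePoints ℝ) : ∃ x, IsGrlexFeasible θ x ∧ intPoint x = u :=
  by simpa [IsGrlexFeasible] using extremePoints_convexHull_subset hu

theorem eq_of_extremePoint_midpoint {d : ℕ} {θ x a b : Fin d → ℤ}
    (hx : intPoint x ∈ (grlexPolytope θ).extremePoints ℝ) (ha : IsGrlexFeasible θ a)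
    (hb : IsGrlexFeasible θ b) (hab : ∀ i, a i + b i = 2 * x i) : a = x := by
  refine intPoint_injective (hx.2 ha.mem_grlexPolytope hb.mem_grlexPolytope
    ⟨1 / 2, 1 / 2, by norm_num, by norm_num, by norm_num, ?_⟩)
  funext i
  have : (a i : ℝ) + b i = 2 * x i := by exact_mod_cast hab i
  simp only [intPoint, Pi.add_apply, Pi.smul_apply, smul_eq_mul]
  linarith

/-- A vertex is not the midpoint of two opposite moves. -/
theorem not_moveUnit_feasible {d : ℕ} {θ x : Fin d → ℤ}
    (hx : intPoint x ∈ (grlexPolytope θ).extremePoints ℝ) {a b : Fin d} (hab : a ≠ b)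
    (h1 : IsGrlexFeasible θ (moveUnit x a b)) (h2 : IsGrlexFeasible θ (moveUnit x b a)) :
    False := by
  have := congrFun (eq_of_extremePoint_midpoint hx h1 h2 fun i => by
    simp only [moveUnit]
    ring) a
  simp [moveUnit, hab] at this

/-- Change coordinate `i` by `t`. -/
def shiftCoord {d : ℕ} (x : Fin d → ℤ) (i : Fin d) (t : ℤ) : Fin d → ℤ :=
  fun l => x l + if l = i then t else 0

theorem sum_shiftCoord {d : ℕ} (x : Fin d → ℤ) (i : Fin d) (t : ℤ) :
    ∑ l, shiftCoord x i t l = ∑ l, x l + t := by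
  simp [shiftCoord, Finset.sum_add_distrib]

theorem shiftCoord_nonneg {d : ℕ} {x : Fin d → ℤ} (hx : ∀ l, 0 ≤ x l) {i : Fin d} {t : ℤ}
    (h : 0 ≤ x i + t) (l : Fin d) : 0 ≤ shiftCoord x i t l := by
  have := hx l
  unfold shiftCoord
  split_ifs with hl
  · subst hl
    exact h
  · omega

theorem not_shiftCoord_feasible {d : ℕ} {θ x : Fin d → ℤ}
    (hx : intPoint x ∈ (grlexPolytope θ).extremePoints ℝ) {i : Fin d}
    (h1 : IsGrlexFeasible θ (shiftCoord x i 1)) (h2 : IsGrlexFeasible θ (shiftCoord x i (-1))) :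
    False := by
  have := congrFun (eq_of_extremePoint_midpoint hx h1 h2 fun l => by
    simp only [shiftCoord]
    split_ifs <;> ring) i
  simp [shiftCoord] at this

/-- The vertices strictly below the top layer are `0` and the neighbour `(S - 1) e_d` of `θ`. -/
theorem eq_zero_or_eq_of_extremePoint_of_sum_lt (hθ : ∀ i, 1 ≤ θ i)
    {x : Fin (n + 1) → ℤ} (hxf : IsGrlexFeasible θ x)
    (hx : intPoint x ∈ (grlexPolytope θ).extremePoints ℝ) (hlt : ∑ i, x i < ∑ i, θ i) :
    x = 0 ∨ x = grlexNeighbor θ 0 := by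
  rw [or_iff_not_imp_left]
  intro hne
  obtain ⟨i, hi⟩ : ∃ i, 0 < x i := by
    by_contra! h
    exact hne (funext fun i => le_antisymm (h i) (hxf.1 i))
  have hother : ∀ j, j ≠ i → x j = 0 := by
    intro j hj
    refine le_antisymm ?_ (hxf.1 j)
    by_contra! hpos
    exact not_moveUnit_feasible hx hj (.moveUnit_of_sum_lt hxf.1 hlt hi)
      (.moveUnit_of_sum_lt hxf.1 hlt hpos)
  have hsumx : ∑ l, x l = x i := Finset.sum_eq_single i (fun j _ => hother j) (by simp)
  have hdown : IsGrlexFeasible θ (shiftCoord x i (-1)) :=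
    .of_sum_lt (shiftCoord_nonneg hxf.1 (by omega)) (by rw [sum_shiftCoord]; omega)
  have hup : ¬ IsGrlexFeasible θ (shiftCoord x i 1) :=
    fun h => not_shiftCoord_feasible hx h hdown
  have hlevel : ∑ l, x l = ∑ l, θ l - 1 := by
    by_contra h
    exact hup (.of_sum_lt (shiftCoord_nonneg hxf.1 (by omega)) (by rw [sum_shiftCoord]; omega))
  -- At sum `S - 1`, adding a unit at `i ≠ Fin.last n` reaches the top layer with last coordinate `0
  -- < θ (Fin.last n)`, which is feasible.
  have hlast : i = Fin.last n := by
    by_contra h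
    refine hup (.of_lt (shiftCoord_nonneg hxf.1 (by omega)) (by rw [sum_shiftCoord]; omega)
      (Fin.last n) ?_ fun k hk => absurd hk (Fin.le_last k).not_gt)
    have h1 := hother (Fin.last n) (Ne.symm h)
    have h2 := hθ (Fin.last n)
    simp only [shiftCoord, h1, if_neg (Ne.symm h)]
    omega
  funext l
  rw [grlexNeighbor_zero]
  split_ifs with hl
  · rw [hl, ← hlast]
    omega
  · exact hother l (hlast ▸ hl)

/-- Every vertex of the top layer other than `θ` has one of its first two coordinates zero. -/
theorem eq_zero_of_extremePoint_of_sum_eq {θ x : Fin (n + 2) → ℤ}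
    (hxf : IsGrlexFeasible θ x) (hx : intPoint x ∈ (grlexPolytope θ).extremePoints ℝ)
    (hsum : ∑ i, x i = ∑ i, θ i) (hne : x ≠ θ) (h0 : 0 < x 0) (h1 : 0 < x 1) : False := by
  rcases hxf.2 with hlt | ⟨-, h | ⟨i, hi, hgt⟩⟩
  · omega
  · exact hne h
  have h01 : (0 : Fin (n + 2)) ≠ 1 := by simp
  induction i using Fin.cases with
  | zero =>
    rw [Fin.sum_univ_succ x, Fin.sum_univ_succ θ,
      Finset.sum_congr rfl fun l _ => hgt (Fin.succ l) (Fin.succ_pos l)] at hsum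
    omega
  | succ i =>
    induction i using Fin.cases with
    | zero =>
      have hs : (Fin.succ 0 : Fin (n + 2)) = 1 := rfl
      rw [hs] at hi hgt
      have hgt' : ∀ l : Fin n, x l.succ.succ = θ l.succ.succ := fun l =>
        hgt _ (by rw [← hs]; exact Fin.succ_lt_succ_iff.2 (Fin.succ_pos l))
      have hsum2 : x 0 + x 1 = θ 0 + θ 1 := by
        rw [Fin.sum_univ_succ x, Fin.sum_univ_succ θ, Fin.sum_univ_succ fun l => x l.succ,
          Fin.sum_univ_succ fun l => θ l.succ,
          Finset.sum_congr rfl fun l _ => hgt' l, hs] at hsum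
        omega
      have hdown : IsGrlexFeasible θ (moveUnit x 0 1) := by
        refine .of_lt (moveUnit_nonneg hxf.1 h1) (by rwa [sum_moveUnit]) 1 ?_ fun k hk => ?_
        · simp only [moveUnit, h01.symm, if_true, if_false]
          omega
        · have hk0 : k ≠ 0 := Fin.ne_zero_of_lt hk
          simp [moveUnit, hk.ne', hk0, hgt k hk]
      refine not_moveUnit_feasible hx h01 hdown ?_
      have hup : ∀ k, 1 < k → moveUnit x 1 0 k = θ k := fun k hk => by
        have hk0 : k ≠ 0 := Fin.ne_zero_of_lt hk
        simp [moveUnit, hk.ne', hk0, hgt k hk]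
      have hup1 : moveUnit x 1 0 1 = x 1 + 1 := by simp [moveUnit]
      have hup0 : moveUnit x 1 0 0 = x 0 - 1 := by simp [moveUnit]
      -- When the raised coordinate reaches `θ 1`, the moved point is `θ` itself, still feasible.
      rcases (show x 1 + 1 ≤ θ 1 by omega).eq_or_lt with h | h
      · refine ⟨moveUnit_nonneg hxf.1 h0, Or.inr ⟨by rwa [sum_moveUnit], Or.inl ?_⟩⟩
        funext k
        induction k using Fin.cases with
        | zero =>
          rw [hup0]
          omega
        | succ k =>
          induction k using Fin.cases with
          | zero => rw [hs, hup1, h]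
          | succ k =>
            exact hup _ (by rw [← hs]; exact Fin.succ_lt_succ_iff.2 (Fin.succ_pos k))
      · exact .of_lt (moveUnit_nonneg hxf.1 h0) (by rwa [sum_moveUnit]) 1 (hup1 ▸ h) hup
    | succ i =>
      have hi1 : (1 : Fin (n + 2)) < i.succ.succ :=
        Fin.succ_lt_succ_iff.2 (Fin.succ_pos i)
      have hi0 : (0 : Fin (n + 2)) < i.succ.succ := Fin.succ_pos _
      exact not_moveUnit_feasible hx h01 (.moveUnit_of_lt hxf.1 hsum hi hgt hi0 hi1 h1)
        (.moveUnit_of_lt hxf.1 hsum hi hgt hi1 hi0 h0)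

/-- The antipode of a vertex strictly below the top layer. -/
theorem eq_of_antipodal_of_sum_lt {θ : Fin (n + 3) → ℤ} (hθ : ∀ i, 1 ≤ θ i)
    {x y : Fin (n + 3) → ℤ} (hxf : IsGrlexFeasible θ x) (hyf : IsGrlexFeasible θ y)
    (h : IsAntipodalVertexPair (grlexPolytope θ) (intPoint x) (intPoint y))
    (hlt : ∑ i, x i < ∑ i, θ i) : x = 0 ∧ y = θ := by
  obtain ⟨hx, hy, hne, hfacet⟩ := h
  have hzero := isSimpleVertex_zero (by omega) hθ
  have htop := isSimpleVertex_intPoint hθ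
  have hcoord : ∀ i, x i = 0 → 0 < y i := by
    intro i hi
    refine lt_of_le_of_ne (hyf.1 i) fun hyi => ?_
    refine hfacet _ (hzero.isFacet_levelFace card_fin_eq_finrank i)
      ⟨⟨hxf.mem_grlexPolytope, ?_⟩, ⟨hyf.mem_grlexPolytope, ?_⟩⟩
    · simp [negCoord_apply, intPoint, hi]
    · simp [negCoord_apply, intPoint, ← hyi]
  have hl0 : (0 : Fin (n + 3)) ≠ Fin.last (n + 2) := (Fin.last_pos).ne
  have hl1 : (1 : Fin (n + 3)) ≠ Fin.last (n + 2) := by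
    rw [Ne, Fin.ext_iff]
    simp
  -- This is where `d ≥ 3` enters: the last coordinate is neither of the first two.
  have hx01 : x 0 = 0 ∧ x 1 = 0 := by
    rcases eq_zero_or_eq_of_extremePoint_of_sum_lt hθ hxf hx hlt with rfl | rfl
    · exact ⟨rfl, rfl⟩
    · simp [grlexNeighbor_zero, hl0, hl1]
  have hy0 := hcoord 0 hx01.1
  have hy1 := hcoord 1 hx01.2
  have hysum : ∑ i, y i = ∑ i, θ i := by
    refine hyf.sum_le.antisymm (not_lt.1 fun hylt => ?_)
    rcases eq_zero_or_eq_of_extremePoint_of_sum_lt hθ hyf hy hylt with rfl | rfl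
    · exact hy0.ne rfl
    · simp [grlexNeighbor_zero, hl0] at hy0
  have hyθ : y = θ := by
    by_contra hyne
    exact eq_zero_of_extremePoint_of_sum_eq hyf hy hysum hyne hy0 hy1
  refine ⟨(eq_zero_or_eq_of_extremePoint_of_sum_lt hθ hxf hx hlt).resolve_right fun hxq => ?_, hyθ⟩
  -- The neighbour with index 0 lies on every facet at `θ` of nonzero index, so index 1 serves.
  refine hfacet _ (htop.isFacet_levelFace card_fin_eq_finrank 1)
    ⟨⟨hxf.mem_grlexPolytope, ?_⟩, ?_⟩
  · rw [hxq]
    exact htop.tight 1 0 (by simp)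
  · rw [hyθ]
    exact htop.mem_levelFace 1

theorem IsAntipodalVertexPair.symm {E : Type*} [NormedAddCommGroup E] [NormedSpace ℝ E] {X : Set E}
    {u v : E} (h : IsAntipodalVertexPair X u v) : IsAntipodalVertexPair X v u :=
  ⟨h.2.1, h.1, h.2.2.1.symm, fun F hF hvu => h.2.2.2 F hF hvu.symm⟩

theorem eq_of_isAntipodalVertexPair {θ : Fin (n + 3) → ℤ} (hθ : ∀ i, 1 ≤ θ i)
    {u v : Fin (n + 3) → ℝ} (h : IsAntipodalVertexPair (grlexPolytope θ) u v) :
    (u = 0 ∧ v = intPoint θ) ∨ (u = intPoint θ ∧ v = 0) := by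
  obtain ⟨x, hxf, rfl⟩ := exists_of_mem_extremePoints h.1
  obtain ⟨y, hyf, rfl⟩ := exists_of_mem_extremePoints h.2.1
  rcases hxf.sum_le.lt_or_eq with hxlt | hxeq
  · obtain ⟨rfl, rfl⟩ := eq_of_antipodal_of_sum_lt hθ hxf hyf h hxlt
    exact Or.inl ⟨intPoint_zero, rfl⟩
  rcases hyf.sum_le.lt_or_eq with hylt | hyeq
  · obtain ⟨rfl, rfl⟩ := eq_of_antipodal_of_sum_lt hθ hyf hxf h.symm hylt
    exact Or.inr ⟨rfl, intPoint_zero⟩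
  exfalso
  have htop := isSimpleVertex_intPoint hθ
  -- The facet normal of index 0 is the coordinate sum, so this facet contains the whole top layer.
  refine h.2.2.2 _ (htop.isFacet_levelFace card_fin_eq_finrank 0)
    ⟨⟨hxf.mem_grlexPolytope, ?_⟩, ⟨hyf.mem_grlexPolytope, ?_⟩⟩
  · rw [pairingCLM_intPoint, pairingCLM_intPoint, pairing_facetCoeff_zero,
      pairing_facetCoeff_zero, hxeq]
  · rw [pairingCLM_intPoint, pairingCLM_intPoint, pairing_facetCoeff_zero,
      pairing_facetCoeff_zero, hyeq]

end GrlexPolytope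

theorem theorem3p1 (d : ℕ) (hd : 3 ≤ d) (θ : Fin d → ℤ) (hθ : ∀ i, 1 ≤ θ i) :
    IsDantzigFigure d (grlexPolytope θ) 0 (intPoint θ) ∧
    (∀ F : Set (Fin d → ℝ), IsFacet (grlexPolytope θ) F → (0 ∈ F ∨ intPoint θ ∈ F)) ∧
    (∀ u v : Fin d → ℝ, IsAntipodalVertexPair (grlexPolytope θ) u v ↔
      ((u = 0 ∧ v = intPoint θ) ∨ (u = intPoint θ ∧ v = 0))) := by
  obtain ⟨n, rfl⟩ := Nat.exists_eq_add_of_le' hd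
  have hn : 1 ≤ n + 2 := by omega
  have hanti := isAntipodalVertexPair_zero_intPoint hn hθ
  refine ⟨⟨⟨isDPolytope_grlexPolytope hn hθ, encard_facets hn hθ⟩, hanti⟩,
    fun F hF => zero_mem_facet_or_intPoint_mem_facet hn hθ hF,
    fun u v => ⟨eq_of_isAntipodalVertexPair hθ, ?_⟩⟩
  rintro (⟨rfl, rfl⟩ | ⟨rfl, rfl⟩)
  · exact hanti
  · exact hanti.symm
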